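/- Theorem. Let $\mathbb{RP}^2=S^2/\{\pm1\}$ be the real projective plane (with the quotient topology) and let $f:\mathbb{RP}^2\to\mathbb{R}$ be continuous. Definitions. (i) A number $a\in\mathbb{R}$ is in the homotopy significant spectrum of $f$ if there is no homotopy (continuous map) $H:\{f\le a\}\times[0,1]\to\mathbb{RP}^2$ with $H(x,0)=x$ and $f(H(x,1))<a$ for all $x\in\{f\le a\}$. (ii) For $A\subseteq\mathbb{RP}^2$ closed, $\mathrm{cat}(A)$ is the smallest $m\ge 0$ such that $A$ is covered by $m$ closed subsets of $\mathbb{RP}^2$ each of which is contractible in $\mathbb{RP}^2$, i.e. whose inclusion into $\mathbb{RP}^2$ is homotopic to a constant map ($\mathrm{cat}(\emptyset)=0$, and $\mathrm{cat}(A)=\infty$ if there is no such covering). For $k=1,2,3$ put $$\mathsf{hs}_k=\inf_{A\subseteq\mathbb{RP}^2\text{ closed},\ \mathrm{cat}(A)\ge k}\ \sup_{x\in A}f(x).$$ (iii) For $A\subseteq S^2$ closed and symmetric ($A=-A$), the Krasnoselskii genus $\gamma(A)$ is the smallest $m\ge0$ such that there is an odd continuous map $A\to\mathbb{R}^m\setminus\{0\}$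 ($\gamma(\emptyset)=0$, and $\gamma(A)=\infty$ if there is no such $m$). With $\tilde f:S^2\to\mathbb{R}$, $\tilde f(x)=f([x])$, the even function induced by $f$, put for $k=1,2,3$ $$\mathsf{kr}_k=\inf_{A\subseteq S^2\text{ closed, symmetric},\ \gamma(A)\ge k}\ \sup_{x\in A}\tilde f(x);$$ the set $\{\mathsf{kr}_1,\mathsf{kr}_2,\mathsf{kr}_3\}$ is the Krasnoselskii spectrum of $f$. Conclusion. The homotopy significant spectrum of $f$ is exactly $\{\mathsf{hs}_1,\mathsf{hs}_2,\mathsf{hs}_3\}$, and it equals the Krasnoselskii spectrum $\{\mathsf{kr}_1,\mathsf{kr}_2,\mathsf{kr}_3\}$ of $f$. (In particular all these values are real numbers.) -/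

import Mathlib

/-- The antipodal relation `x ∼ y ↔ x = ± y` on the unit sphere of a normed space. -/
def antipodalSetoid (E : Type*) [NormedAddCommGroup E] [NormedSpace ℝ E] :
    Setoid (Metric.sphere (0 : E) 1) where
  r x y := x = y ∨ x = -y
  iseqv :=
    { refl := fun _ => Or.inl rfl
      symm := by
        rintro x y (h | h)
        · exact Or.inl h.symm
        · exact Or.inr (by rw [h, neg_neg])
      trans := by
        rintro x y z (h | h) (h' | h')
        · exact Or.inl (h.trans h')
        · exact Or.inr (h.trans h')
        · exact Or.inr (by rw [h, h'])
        · exact Or.inl (by rw [h, h', neg_neg]) }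

/-- The projective space `S(E) / {±1}` of a real normed space `E`, with the quotient topology. -/
abbrev ProjectiveSpace (E : Type*) [NormedAddCommGroup E] [NormedSpace ℝ E] : Type _ :=
  Quotient (antipodalSetoid E)

/-- Real projective `n`-space, the quotient of the Euclidean unit sphere `S^n ⊆ ℝ^(n+1)` by the
antipodal map. -/
abbrev RP (n : ℕ) : Type := ProjectiveSpace (EuclideanSpace ℝ (Fin (n + 1)))

/-- The homotopy significant spectrum of `f : Φ → ℝ`: all real `a` for which there is no homotopy
`H : Φ_{≤ a} × [0,1] → Φ` (with values in the whole of `Φ`) that starts at the inclusion and ends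
inside `Φ_{< a}`. -/
def homotopySignificantSpectrum {Φ : Type*} [TopologicalSpace Φ] (f : Φ → ℝ) : Set ℝ :=
  {a : ℝ | ¬ ∃ H : C({x : Φ // f x ≤ a} × unitInterval, Φ),
    (∀ x, H (x, 0) = (x : Φ)) ∧ ∀ x, f (H (x, 1)) < a}

/-- A subset `C` of `Φ` is contractible in `Φ` if its inclusion into `Φ` is homotopic to a constant
map. -/
def ContractibleIn {Φ : Type*} [TopologicalSpace Φ] (C : Set Φ) : Prop :=
  (⟨Subtype.val, continuous_subtype_val⟩ : C(C, Φ)).Nullhomotopic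

/-- The Lusternik-Schnirelmann subspace category of `A` in `Φ`: the least `m` such that `A` is
covered by `m` closed sets that are contractible in `Φ`, and `⊤` if there is no such `m`.
(It is `0` for the empty set, by the empty covering.) -/
noncomputable def lsCategory {Φ : Type*} [TopologicalSpace Φ] (A : Set Φ) : ℕ∞ :=
  ⨅ (m : ℕ) (_ : ∃ C : Fin m → Set Φ,
    (∀ i, IsClosed (C i)) ∧ (∀ i, ContractibleIn (C i)) ∧ A ⊆ ⋃ i, C i), (m : ℕ∞)

/-- The min-max value `hs_k` of `f`: the infimum over closed `A ⊆ Φ` of category at least `k` of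
the supremum of `f` on `A`, taken in the extended reals. -/
noncomputable def hs {Φ : Type*} [TopologicalSpace Φ] (f : Φ → ℝ) (k : ℕ) : EReal :=
  ⨅ (A : Set Φ) (_ : IsClosed A) (_ : (k : ℕ∞) ≤ lsCategory A), ⨆ x ∈ A, (f x : EReal)

/-- The Krasnoselskii genus of a symmetric set `A`: the least `m` such that there is an odd
continuous map `A → ℝ^m \ {0}`, and `⊤` if there is no such `m`.
(It is `0` for the empty set, and at least `1` otherwise since `ℝ^0 \ {0}` is empty.) -/
noncomputable def krasnoselskiiGenus {X : Type*} [TopologicalSpace X] [Neg X] (A : Set X) : ℕ∞ :=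
  ⨅ (m : ℕ) (_ : ∃ h : X → EuclideanSpace ℝ (Fin m),
    ContinuousOn h A ∧ (∀ x ∈ A, h (-x) = -h x) ∧ ∀ x ∈ A, h x ≠ 0), (m : ℕ∞)

/-- The Krasnoselskii eigenvalue `kr_k` of an even function `g` on the unit sphere of `E`: the
infimum over closed symmetric subsets `A` of the sphere of genus at least `k` of the supremum of `g`
on `A`, taken in the extended reals. -/
noncomputable def kr {E : Type*} [NormedAddCommGroup E] [NormedSpace ℝ E]
    (g : Metric.sphere (0 : E) 1 → ℝ) (k : ℕ) : EReal :=
  ⨅ (A : Set (Metric.sphere (0 : E) 1)) (_ : IsClosed A) (_ : ∀ x ∈ A, -x ∈ A)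
    (_ : (k : ℕ∞) ≤ krasnoselskiiGenus A), ⨆ x ∈ A, (g x : EReal)

/-- The even function on the unit sphere induced by a function on the projective space. -/
def sphereLift {E : Type*} [NormedAddCommGroup E] [NormedSpace ℝ E]
    (f : ProjectiveSpace E → ℝ) : Metric.sphere (0 : E) 1 → ℝ :=
  fun x => f (Quotient.mk (antipodalSetoid E) x)

/-! Everything is measured by the genus of preimages in the sphere. A closed set is contractible in
projective space exactly when its preimage has an odd map to the nonzero reals, and a covering by
`m` such sets corresponds to a nonvanishing odd map to `ℝ^m`. So category equals genus of the
preimage, and `hs_eq_kr` follows. By compactness a nonvanishing odd map on a sublevel set stays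
nonvanishing on a slightly higher one, so `kr_k ≤ a` means that `{f̃ ≤ a}` has genus at least `k`
(`kr_le_iff`).

Min-max values are significant: a deformation of `{f ≤ a}` into `{f < a}` lifts to an odd map of
`{f̃ ≤ a}` into some `{f̃ ≤ b}` with `b < a` (`exists_odd_lift`). The genus of `{f̃ ≤ b}` is then at
least that of `{f̃ ≤ a}`, so no `kr_k` equals `a`.

Conversely, let `a` differ from all three values, so that every `kr_k ≤ a` is `< a`. If `{f ≤ a}`
has genus one, it contracts to a point of `{f < a}`. If it has genus at least two but is not the
whole plane, then `{f < a}` contains a nontrivial loop; the plane minus a point retracts to a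
projective line, which can be moved onto that loop (`exists_deformation_of_joinedIn`). If it is the
whole plane, Borsuk-Ulam gives genus three, and since a proper subset has genus at most two, `f < a`
everywhere. -/

open Metric Set
open scoped unitInterval RealInnerProductSpace

/-! ### Projective space as an open quotient of the sphere; descent of odd families -/

section Projective

variable {V : Type*} [NormedAddCommGroup V] [NormedSpace ℝ V]

/-- The quotient map from the unit sphere to the projective space. -/
def antipodalMk (x : sphere (0 : V) 1) : ProjectiveSpace V :=
  Quotient.mk (antipodalSetoid V) x

theorem antipodalMk_eq_iff {x y : sphere (0 : V) 1} :
    antipodalMk x = antipodalMk y ↔ x = y ∨ x = -y :=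
  Quotient.eq (r := antipodalSetoid V)

theorem antipodalMk_neg (x : sphere (0 : V) 1) : antipodalMk (-x) = antipodalMk x :=
  antipodalMk_eq_iff.2 (Or.inr rfl)

theorem antipodalMk_surjective : Function.Surjective (antipodalMk (V := V)) :=
  Quotient.mk_surjective

theorem continuous_antipodalMk : Continuous (antipodalMk (V := V)) :=
  continuous_quotient_mk'

/-- Openness is recorded because open quotient maps survive restriction to preimages and products,
which is what lets homotopies on the sphere descend. -/
theorem isOpenQuotientMap_antipodalMk : IsOpenQuotientMap (antipodalMk (V := V)) := by
  refine ⟨antipodalMk_surjective, continuous_antipodalMk, fun U hU => ?_⟩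
  have hq : Topology.IsQuotientMap (antipodalMk (V := V)) := isQuotientMap_quotient_mk'
  rw [← hq.isOpen_preimage]
  have : antipodalMk ⁻¹' (antipodalMk '' U) = U ∪ (fun x => -x) ⁻¹' U := by
    ext x
    simp only [mem_preimage, mem_image, mem_union]
    constructor
    · rintro ⟨y, hy, h⟩
      rcases antipodalMk_eq_iff.1 h with rfl | rfl
      · exact Or.inl hy
      · exact Or.inr hy
    · rintro (h | h)
      · exact ⟨x, h, rfl⟩
      · exact ⟨-x, h, antipodalMk_neg x⟩
  rw [this]
  exact hU.union (hU.preimage continuous_neg)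

/-- The line spanned by a nonzero vector, as a point of the projective space. -/
noncomputable def projPoint (v : {v : V // v ≠ 0}) : ProjectiveSpace V :=
  antipodalMk ⟨‖(v : V)‖⁻¹ • (v : V), by
    simp [norm_smul, inv_mul_cancel₀ (norm_ne_zero_iff.2 v.2)]⟩

theorem continuous_projPoint : Continuous (projPoint (V := V)) := by
  refine continuous_antipodalMk.comp (Continuous.subtype_mk ?_ _)
  exact (continuous_subtype_val.norm.inv₀ fun v => norm_ne_zero_iff.2 v.2).smul
    continuous_subtype_val

theorem projPoint_neg {v w : {v : V // v ≠ 0}} (h : (w : V) = -v) :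
    projPoint w = projPoint v := by
  refine antipodalMk_eq_iff.2 (Or.inr ?_)
  ext1
  simp [h]

theorem projPoint_eq_antipodalMk {v : {v : V // v ≠ 0}} {x : sphere (0 : V) 1} (r : ℝ)
    (h : (v : V) = r • (x : V)) : projPoint v = antipodalMk x := by
  have hr : r ≠ 0 := by
    rintro rfl
    exact v.2 (by simp [h])
  have hx : ‖(x : V)‖ = 1 := norm_eq_of_mem_sphere x
  rw [projPoint, antipodalMk_eq_iff]
  rcases hr.lt_or_gt with h' | h'
  · right
    ext1
    simp [h, norm_smul, hx, smul_smul, abs_of_neg h', inv_mul_cancel₀ hr]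
  · left
    ext1
    simp [h, norm_smul, hx, smul_smul, abs_of_pos h', inv_mul_cancel₀ hr]

/-- A family of nonvanishing odd maps on the preimage of `K` descends to a homotopy on `K`. -/
theorem exists_descent {K : Set (ProjectiveSpace V)}
    (F : C((antipodalMk ⁻¹' K : Set (sphere (0 : V) 1)) × I, V)) (h0 : ∀ z, F z ≠ 0)
    (hodd : ∀ (x y : (antipodalMk ⁻¹' K : Set (sphere (0 : V) 1))) (t : I),
      (y : sphere (0 : V) 1) = -x → F (y, t) = -F (x, t)) :
    ∃ H : C(K × I, ProjectiveSpace V), ∀ x t,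
      H (K.restrictPreimage antipodalMk x, t) = projPoint ⟨F (x, t), h0 _⟩ := by
  have hq := ((isOpenQuotientMap_antipodalMk (V := V)).restrictPreimage K).prodMap
    (IsOpenQuotientMap.id (X := I))
  let G : C((antipodalMk ⁻¹' K : Set (sphere (0 : V) 1)) × I, ProjectiveSpace V) :=
    ⟨fun z => projPoint ⟨F z, h0 z⟩,
      continuous_projPoint.comp (F.continuous.subtype_mk _)⟩
  let q : C((antipodalMk ⁻¹' K : Set (sphere (0 : V) 1)) × I, K × I) := ⟨_, hq.continuous⟩
  have hG : Function.FactorsThrough G q := by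
    rintro ⟨x, t⟩ ⟨y, s⟩ h
    obtain ⟨h1, h2⟩ := Prod.ext_iff.1 h
    replace h1 : antipodalMk (x : sphere (0 : V) 1) = antipodalMk (y : sphere (0 : V) 1) :=
      congrArg Subtype.val h1
    replace h2 : t = s := h2
    subst h2
    rcases antipodalMk_eq_iff.1 h1 with h | h
    · rw [Subtype.ext h]
    · exact projPoint_neg (hodd y x t h)
  refine ⟨Topology.IsQuotientMap.lift (f := q) hq.isQuotientMap G hG, fun x t => ?_⟩
  exact DFunLike.congr_fun (Topology.IsQuotientMap.lift_comp (f := q) hq.isQuotientMap G hG) (x, t)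

end Projective

/-! ### Lifting deformations of sets of lines to odd maps -/

section Lifting

variable {V : Type*} [NormedAddCommGroup V] [InnerProductSpace ℝ V]

/-- The orthogonal projection of a vector to a line. -/
noncomputable def lineProj (z : ProjectiveSpace V) (v : V) : V :=
  Quotient.lift (s := antipodalSetoid V) (fun x : sphere (0 : V) 1 => ⟪(x : V), v⟫ • (x : V))
    (by rintro x y (rfl | rfl) <;> simp) z

theorem lineProj_antipodalMk (x : sphere (0 : V) 1) (v : V) :
    lineProj (antipodalMk x) v = ⟪(x : V), v⟫ • (x : V) := rfl

theorem continuous_lineProj : Continuous fun p : ProjectiveSpace V × V => lineProj p.1 p.2 := by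
  rw [← ((isOpenQuotientMap_antipodalMk (V := V)).prodMap
    (IsOpenQuotientMap.id (X := V))).continuous_comp_iff]
  change Continuous fun p : sphere (0 : V) 1 × V => ⟪(p.1 : V), p.2⟫ • (p.1 : V)
  fun_prop

/-- The squared cosine of the angle between two lines. -/
noncomputable def lineCosSq (z w : ProjectiveSpace V) : ℝ :=
  Quotient.lift (s := antipodalSetoid V) (fun x : sphere (0 : V) 1 => ⟪(x : V), lineProj w x⟫)
    (by
      obtain ⟨y, rfl⟩ := antipodalMk_surjective w
      rintro x x' (rfl | rfl) <;> simp [lineProj_antipodalMk]) z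

theorem lineCosSq_antipodalMk (x y : sphere (0 : V) 1) :
    lineCosSq (antipodalMk x) (antipodalMk y) = ⟪(y : V), x⟫ * ⟪(x : V), y⟫ :=
  real_inner_smul_right _ _ _

theorem lineCosSq_self (z : ProjectiveSpace V) : lineCosSq z z = 1 := by
  obtain ⟨x, rfl⟩ := antipodalMk_surjective z
  simp [lineCosSq_antipodalMk]

theorem continuous_lineCosSq :
    Continuous fun p : ProjectiveSpace V × ProjectiveSpace V => lineCosSq p.1 p.2 := by
  rw [← ((isOpenQuotientMap_antipodalMk (V := V)).prodMap
    (isOpenQuotientMap_antipodalMk (V := V))).continuous_comp_iff]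
  change Continuous fun p : sphere (0 : V) 1 × sphere (0 : V) 1 =>
    lineCosSq (antipodalMk p.1) (antipodalMk p.2)
  simp only [lineCosSq_antipodalMk]
  fun_prop

variable [FiniteDimensional ℝ V]

/-- The end of a deformation of a closed set of lines lifts to an odd map. -/
theorem exists_odd_lift {K : Set (ProjectiveSpace V)} (hK : IsClosed K)
    (H : C(K × I, ProjectiveSpace V)) (H0 : ∀ x, H (x, 0) = x) :
    ∃ g : C((antipodalMk ⁻¹' K : Set (sphere (0 : V) 1)), V),
      (∀ x y : (antipodalMk ⁻¹' K : Set (sphere (0 : V) 1)),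
        (y : sphere (0 : V) 1) = -x → g y = -g x) ∧
      ∀ x, ∃ y : sphere (0 : V) 1, antipodalMk y = H (K.restrictPreimage antipodalMk x, 1) ∧
        ∃ r : ℝ, r ≠ 0 ∧ g x = r • (y : V) := by
  have hcB : IsClosed (antipodalMk ⁻¹' K : Set (sphere (0 : V) 1)) :=
    hK.preimage continuous_antipodalMk
  set B : Set (sphere (0 : V) 1) := antipodalMk ⁻¹' K
  have : CompactSpace B := isCompact_iff_compactSpace.1 hcB.isCompact
  have hm : Continuous (K.restrictPreimage (antipodalMk (V := V))) :=
    continuous_antipodalMk.restrictPreimage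
  let L : B → I → ProjectiveSpace V := fun x t => H (K.restrictPreimage antipodalMk x, t)
  have hL : Continuous fun p : B × I => L p.1 p.2 :=
    H.continuous.comp ((hm.comp continuous_fst).prodMk continuous_snd)
  have hLneg : ∀ (x y : B) t, (y : sphere (0 : V) 1) = -x → L y t = L x t := by
    intro x y t h
    have : K.restrictPreimage antipodalMk y = K.restrictPreimage antipodalMk x := by
      ext1
      simp [Set.restrictPreimage, h, antipodalMk_neg]
    simp [L, this]
  -- The squared cosine is 1 at equal times, so uniform continuity keeps the lines at nearby times
  -- from being orthogonal, uniformly in `x`.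
  obtain ⟨δ, hδ, hclose⟩ : ∃ δ > 0, ∀ (x : B) (s t : I), dist s t < δ →
      lineCosSq (L x s) (L x t) ≠ 0 := by
    have hc : Continuous fun p : B × I × I => lineCosSq (L p.1 p.2.1) (L p.1 p.2.2) :=
      continuous_lineCosSq.comp ((hL.comp (continuous_fst.prodMk continuous_snd.fst)).prodMk
        (hL.comp (continuous_fst.prodMk continuous_snd.snd)))
    obtain ⟨δ, hδ, h⟩ := Metric.uniformContinuous_iff.1
      (CompactSpace.uniformContinuous_of_continuous hc) 1 one_pos
    refine ⟨δ, hδ, fun x s t hst h0 => ?_⟩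
    have := @h (x, s, t) (x, t, t) (by simp [Prod.dist_eq, hst])
    simp [h0, lineCosSq_self] at this
  let T : Set I := {t | ∃ g : C(B, V), (∀ x y : B, (y : sphere (0 : V) 1) = -x → g y = -g x) ∧
      ∀ x, ∃ y : sphere (0 : V) 1, antipodalMk y = L x t ∧ ∃ r : ℝ, r ≠ 0 ∧ g x = r • (y : V)}
  -- A lift at time `s` becomes one at time `t` by projecting orthogonally to the new line; this
  -- replaces path lifting in the double cover. As `δ` is uniform, `T` is clopen.
  have step : ∀ s t, dist s t < δ → s ∈ T → t ∈ T := by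
    rintro s t hst ⟨g, hodd, hg⟩
    refine ⟨⟨fun x => lineProj (L x t) (g x), continuous_lineProj.comp
      ((hL.comp (continuous_id.prodMk continuous_const)).prodMk g.continuous)⟩, ?_, fun x => ?_⟩
    · intro x y h
      obtain ⟨z, hz⟩ := antipodalMk_surjective (L x t)
      simp [hodd x y h, hLneg x y t h, ← hz, lineProj_antipodalMk]
    · obtain ⟨y, hy, r, hr, hgr⟩ := hg x
      obtain ⟨z, hz⟩ := antipodalMk_surjective (L x t)
      have := hclose x s t hst
      rw [← hy, ← hz, lineCosSq_antipodalMk] at this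
      refine ⟨z, hz, ⟪(z : V), g x⟫, ?_, ?_⟩
      · rw [hgr, real_inner_smul_right]
        exact mul_ne_zero hr (left_ne_zero_of_mul this)
      · simp [← hz, lineProj_antipodalMk]
  have hT : T = univ := by
    refine IsClopen.eq_univ ⟨⟨?_⟩, ?_⟩ ⟨0, ⟨fun x => (x : sphere (0 : V) 1), by fun_prop⟩, ?_, ?_⟩
    · refine Metric.isOpen_iff.2 fun t ht => ⟨δ, hδ, fun s hs hsT => ht (step s t hs hsT)⟩
    · refine Metric.isOpen_iff.2 fun t ht => ⟨δ, hδ, fun s hs => step t s ?_ ht⟩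
      rwa [dist_comm]
    · intro x y h
      simp [h]
    · intro x
      exact ⟨x, by simp [L, H0], 1, one_ne_zero, by simp⟩
  have h1 : (1 : I) ∈ T := hT ▸ mem_univ _
  exact h1

end Lifting

/-! ### Genus through globally defined odd maps -/

section Genus

/-- There is an odd continuous map to `ℝ^m` without zeros on `B`. -/
def OddNonvanishing {X : Type*} [TopologicalSpace X] [Neg X] (B : Set X) (m : ℕ) : Prop :=
  ∃ h : C(X, EuclideanSpace ℝ (Fin m)), (∀ x, h (-x) = -h x) ∧ ∀ x ∈ B, h x ≠ 0

theorem OddNonvanishing.mono {X : Type*} [TopologicalSpace X] [Neg X] {B B' : Set X} {m : ℕ}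
    (h : OddNonvanishing B' m) (hB : B ⊆ B') : OddNonvanishing B m := by
  obtain ⟨h, h1, h2⟩ := h
  exact ⟨h, h1, fun x hx => h2 x (hB hx)⟩

variable {X : Type*} [TopologicalSpace X] [NormalSpace X] [InvolutiveNeg X] [ContinuousNeg X]

/-- Tietze extension followed by taking the odd part. Genus can thus be tested by odd maps on all of
`X`, which are still available just outside `B`. -/
theorem exists_odd_extension {W : Type*} [NormedAddCommGroup W] [NormedSpace ℝ W]
    [FiniteDimensional ℝ W] {B : Set X} (hB : IsClosed B) (hneg : ∀ x ∈ B, -x ∈ B)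
    (g : C(B, W)) (hg : ∀ x y : B, (y : X) = -x → g y = -g x) :
    ∃ G : C(X, W), (∀ x, G (-x) = -G x) ∧ ∀ x : B, G x = g x := by
  obtain ⟨G, hG⟩ := g.exists_restrict_eq hB
  have hG' : ∀ x : B, G x = g x := fun x => DFunLike.congr_fun hG x
  refine ⟨⟨fun x => (2⁻¹ : ℝ) • (G x - G (-x)), by fun_prop⟩, fun x => ?_, fun x => ?_⟩
  · simp [← smul_neg]
  · have h1 : G (-(x : X)) = -g x := by
      rw [← hg x ⟨-x, hneg x x.2⟩ rfl, ← hG']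
    simp only [ContinuousMap.coe_mk, hG' x, h1, sub_neg_eq_add, ← two_smul ℝ (g x), smul_smul]
    norm_num

theorem OddNonvanishing.of_continuousMap {B : Set X} (hB : IsClosed B) (hneg : ∀ x ∈ B, -x ∈ B)
    {m : ℕ} (g : C(B, EuclideanSpace ℝ (Fin m)))
    (hg : ∀ x y : B, (y : X) = -x → g y = -g x) (h0 : ∀ x, g x ≠ 0) : OddNonvanishing B m := by
  obtain ⟨G, h1, h2⟩ := exists_odd_extension hB hneg g hg
  exact ⟨G, h1, fun x hx => h2 ⟨x, hx⟩ ▸ h0 _⟩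

theorem krasnoselskiiGenus_eq {B : Set X} (hB : IsClosed B) (hneg : ∀ x ∈ B, -x ∈ B) :
    krasnoselskiiGenus B = ⨅ (m : ℕ) (_ : OddNonvanishing B m), (m : ℕ∞) := by
  unfold krasnoselskiiGenus
  refine iInf_congr fun m => iInf_congr_Prop ⟨?_, ?_⟩ fun _ => rfl
  · rintro ⟨h, h1, h2, h3⟩
    refine .of_continuousMap hB hneg
      ⟨B.domRestrict h, continuousOn_iff_continuous_domRestrict.1 h1⟩ ?_ fun x => h3 x x.2
    intro x y hxy
    simp [hxy, h2 x x.2]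
  · rintro ⟨h, h1, h2⟩
    exact ⟨h, h.continuous.continuousOn, fun x _ => h1 x, h2⟩

theorem natCast_le_krasnoselskiiGenus_iff {B : Set X} (hB : IsClosed B)
    (hneg : ∀ x ∈ B, -x ∈ B) {k : ℕ} :
    (k : ℕ∞) ≤ krasnoselskiiGenus B ↔ ∀ m < k, ¬ OddNonvanishing B m := by
  rw [krasnoselskiiGenus_eq hB hneg]
  simp only [le_iInf_iff, Nat.cast_le]
  exact forall_congr' fun m => ⟨fun h hm h' => absurd (h h') (not_le.2 hm),
    fun h h' => not_lt.1 fun hm => h hm h'⟩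

end Genus

/-! ### Lusternik-Schnirelmann category equals genus of the preimage -/

section Category

theorem preimage_image_antipodalMk {V : Type*} [NormedAddCommGroup V] [NormedSpace ℝ V]
    {B : Set (sphere (0 : V) 1)} (hneg : ∀ x ∈ B, -x ∈ B) :
    antipodalMk ⁻¹' (antipodalMk '' B) = B := by
  refine Subset.antisymm ?_ (subset_preimage_image _ _)
  rintro x ⟨y, hy, h⟩
  rcases antipodalMk_eq_iff.1 h with rfl | rfl
  · exact hy
  · simpa using hneg _ hy

theorem neg_mem_preimage_antipodalMk {V : Type*} [NormedAddCommGroup V] [NormedSpace ℝ V]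
    (A : Set (ProjectiveSpace V)) : ∀ x ∈ antipodalMk ⁻¹' A, -x ∈ antipodalMk ⁻¹' A := by
  intro x hx
  rwa [mem_preimage, antipodalMk_neg]

theorem isClosed_image_antipodalMk {V : Type*} [NormedAddCommGroup V] [NormedSpace ℝ V]
    {B : Set (sphere (0 : V) 1)} (hB : IsClosed B) (hneg : ∀ x ∈ B, -x ∈ B) :
    IsClosed (antipodalMk '' B) := by
  rw [← isOpenQuotientMap_antipodalMk.isQuotientMap.isClosed_preimage,
    preimage_image_antipodalMk hneg]
  exact hB

variable {V : Type*} [NormedAddCommGroup V] [InnerProductSpace ℝ V] [FiniteDimensional ℝ V]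

/-- The contraction ends at a single line `[p]`, so its odd lift ends in nonzero multiples of `p`;
pairing with `p` gives the required function. -/
theorem oddNonvanishing_of_contractibleIn {C : Set (ProjectiveSpace V)} (hC : IsClosed C)
    (h : ContractibleIn C) : OddNonvanishing (antipodalMk ⁻¹' C) 1 := by
  obtain ⟨c, ⟨H⟩⟩ := h
  obtain ⟨p, rfl⟩ := antipodalMk_surjective c
  obtain ⟨g, hodd, hg⟩ := exists_odd_lift hC (H.toContinuousMap.comp ContinuousMap.prodSwap)
    (fun x => H.apply_zero x)
  refine .of_continuousMap (hC.preimage continuous_antipodalMk) (neg_mem_preimage_antipodalMk C)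
    ⟨fun x => WithLp.toLp 2 fun _ => ⟪(p : V), g x⟫, by fun_prop⟩ ?_ fun x => ?_
  · intro x y hxy
    ext i
    simp [hodd x y hxy]
  · obtain ⟨y, hy, r, hr, hgr⟩ := hg x
    have hy' : antipodalMk y = antipodalMk p := hy.trans (H.apply_one _)
    have hp : ‖(p : V)‖ = 1 := norm_eq_of_mem_sphere p
    rcases antipodalMk_eq_iff.1 hy' with rfl | rfl <;>
    simp [hgr, real_inner_smul_right, hr, funext_iff]

-- The sign of the odd function selects one point of each antipodal pair over `C`. This section
-- misses some point `q`, and can therefore be pushed along chords to `-q` without passing through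
-- the origin.
omit [FiniteDimensional ℝ V] in
theorem contractibleIn_of_oddNonvanishing [Nonempty (sphere (0 : V) 1)]
    {C : Set (ProjectiveSpace V)} (h : OddNonvanishing (antipodalMk ⁻¹' C) 1) :
    ContractibleIn C := by
  obtain ⟨h, hodd, h0⟩ := h
  let B : Set (sphere (0 : V) 1) := antipodalMk ⁻¹' C
  let sg : sphere (0 : V) 1 → ℝ := fun x => h x 0 / |h x 0|
  have hne : ∀ x : B, h (x : sphere (0 : V) 1) 0 ≠ 0 := by
    intro x hx
    refine h0 x x.2 ?_
    ext i
    rw [Subsingleton.elim i 0]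
    exact hx
  have hsg : Continuous fun x : B => sg x := by
    have : Continuous fun x : B => h (x : sphere (0 : V) 1) 0 := by fun_prop
    exact this.div this.abs fun x => abs_ne_zero.2 (hne x)
  have hsgodd : ∀ x, sg (-x) = -sg x := by
    intro x
    simp [sg, hodd, neg_div]
  have hsg1 : ∀ x : B, sg x = 1 ∨ sg x = -1 := by
    intro x
    rcases (hne x).lt_or_gt with h | h
    · right
      simp [sg, abs_of_neg h, div_neg, div_self h.ne]
    · left
      simp [sg, abs_of_pos h, div_self h.ne']
  -- Since `sg` is odd, only one point of a pair `±x` in `B` has the form `sg y • y`; `q` is the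
  -- other one.
  obtain ⟨q, hq⟩ : ∃ q : sphere (0 : V) 1, ∀ x : B, sg x • (x : V) ≠ q := by
    by_cases hB : Nonempty B
    · obtain ⟨x⟩ := hB
      have hx : (x : V) ≠ -x := fun h =>
        ne_neg_of_mem_unit_sphere ℝ x.1 (Subtype.ext h)
      have key : ∀ z : sphere (0 : V) 1, ((z = x ∨ z = -x) → sg z • (z : V) = sg x • (x : V)) := by
        rintro z (rfl | rfl)
        · rfl
        · simp [hsgodd]
      refine ⟨if sg x = 1 then -x else x, fun y hy => ?_⟩
      have hyx : (y : sphere (0 : V) 1) = x ∨ (y : sphere (0 : V) 1) = -x := by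
        have : (y : V) = x ∨ (y : V) = -x := by
          rcases hsg1 y with h1 | h1 <;> rcases hsg1 x with h2 | h2 <;>
          simp only [h1, h2, one_smul, neg_smul, if_true] at hy <;> norm_num at hy <;>
          simp [← hy]
        rcases this with h | h
        · exact Or.inl (Subtype.ext h)
        · exact Or.inr (Subtype.ext h)
      rw [key y hyx] at hy
      rcases hsg1 x with h2 | h2
      · exact hx (by simpa [h2] using hy)
      · exact hx (by norm_num [h2] at hy; exact hy.symm)
    · exact ⟨Classical.arbitrary _, fun x => (hB ⟨x⟩).elim⟩
  -- A zero would force `t = 1/2`, by comparing norms, and then `q = sg x • x`.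
  let F : C(B × I, V) := ⟨fun z => (1 - (z.2 : ℝ)) • (z.1 : V) - ((z.2 : ℝ) * sg z.1) • (q : V), by
    have : Continuous fun z : B × I => sg z.1 := hsg.comp continuous_fst
    exact .sub (by fun_prop) (.smul (.mul (by fun_prop) this) continuous_const)⟩
  have hF0 : ∀ z, F z ≠ 0 := by
    rintro ⟨x, t⟩ hz
    have hz' : (1 - (t : ℝ)) • (x : V) = ((t : ℝ) * sg x) • (q : V) := sub_eq_zero.1 hz
    have hx1 : ‖(x : V)‖ = 1 := norm_eq_of_mem_sphere x.1
    have hn := congrArg norm hz'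
    have h1 : |1 - (t : ℝ)| = |(t : ℝ)| := by
      rcases hsg1 x with h | h <;> simpa [norm_smul, hx1, h] using hn
    have ht : (t : ℝ) = 1 / 2 := by
      rw [abs_of_nonneg (sub_nonneg.2 t.2.2), abs_of_nonneg t.2.1] at h1
      linarith
    apply hq x
    rw [ht] at hz'
    have h2 : (x : V) = sg x • (q : V) := by
      have := congrArg (fun v => (2 : ℝ) • v) hz'
      simp only [smul_smul] at this
      rw [← mul_assoc] at this
      norm_num at this
      exact this
    rcases hsg1 x with h | h <;> rw [h2, h] <;> simp
  obtain ⟨H, hH⟩ := exists_descent F hF0 (by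
    intro x y t hxy
    simp only [F, ContinuousMap.coe_mk, hxy, hsgodd, coe_neg_sphere, smul_neg, mul_neg, neg_smul]
    abel)
  refine ⟨antipodalMk q, ⟨⟨⟨fun z => H (z.2, z.1), by fun_prop⟩, fun z => ?_, fun z => ?_⟩⟩⟩
  · obtain ⟨x, rfl⟩ := (isOpenQuotientMap_antipodalMk.restrictPreimage C).surjective z
    exact (hH x 0).trans (projPoint_eq_antipodalMk 1 (by simp [F]))
  · obtain ⟨x, rfl⟩ := (isOpenQuotientMap_antipodalMk.restrictPreimage C).surjective z
    exact (hH x 1).trans (projPoint_eq_antipodalMk (-sg x) (by simp [F]))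

/-- The `m` scalar functions of a covering are the coordinates of a map to `ℝ^m`; conversely, the
coordinate of largest modulus defines the covering. -/
theorem exists_cover_iff_oddNonvanishing [Nonempty (sphere (0 : V) 1)]
    {A : Set (ProjectiveSpace V)} (hA : IsClosed A) (m : ℕ) :
    (∃ C : Fin m → Set (ProjectiveSpace V), (∀ i, IsClosed (C i)) ∧ (∀ i, ContractibleIn (C i)) ∧
      A ⊆ ⋃ i, C i) ↔ OddNonvanishing (antipodalMk ⁻¹' A) m := by
  constructor
  · rintro ⟨C, hC, hC', hAC⟩
    choose h hodd h0 using fun i => oddNonvanishing_of_contractibleIn (hC i) (hC' i)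
    refine ⟨⟨fun x => WithLp.toLp 2 fun i => h i x 0, by fun_prop⟩, fun x => ?_, fun x hx hx0 => ?_⟩
    · ext i
      simp [hodd]
    · obtain ⟨i, hi⟩ := mem_iUnion.1 (hAC hx)
      refine h0 i x hi ?_
      ext j
      rw [Subsingleton.elim j 0]
      exact congrArg (fun v : EuclideanSpace ℝ (Fin m) => v i) hx0
  · rintro ⟨h, hodd, h0⟩
    -- On `B i` a zero of the coordinate `i` would be a zero of all of `h`.
    let B : Fin m → Set (sphere (0 : V) 1) := fun i =>
      antipodalMk ⁻¹' A ∩ {x | ∀ j, |h x j| ≤ |h x i|}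
    have hB : ∀ i, IsClosed (B i) := by
      intro i
      refine (hA.preimage continuous_antipodalMk).inter ?_
      simp only [Set.ofPred_forall]
      exact isClosed_iInter fun j => isClosed_le (by fun_prop) (by fun_prop)
    have hBneg : ∀ i, ∀ x ∈ B i, -x ∈ B i := by
      rintro i x ⟨hx, hx'⟩
      exact ⟨neg_mem_preimage_antipodalMk A x hx, by simpa [hodd] using hx'⟩
    refine ⟨fun i => antipodalMk '' B i, fun i => isClosed_image_antipodalMk (hB i) (hBneg i),
      fun i => contractibleIn_of_oddNonvanishing ?_, fun z hz => ?_⟩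
    · rw [preimage_image_antipodalMk (hBneg i)]
      refine ⟨⟨fun x => WithLp.toLp 2 fun _ => h x i, by fun_prop⟩, fun x => ?_, fun x hx hx0 => ?_⟩
      · ext j
        simp [hodd]
      · refine h0 x hx.1 ?_
        ext j
        have hi : h x i = 0 := congrArg (fun v : EuclideanSpace ℝ (Fin 1) => v 0) hx0
        simpa [hi] using hx.2 j
    · obtain ⟨x, rfl⟩ := antipodalMk_surjective z
      have hm : Nonempty (Fin m) := by
        by_contra hm
        rw [not_nonempty_iff] at hm
        exact h0 x hz (Subsingleton.elim _ _)
      obtain ⟨i, hi⟩ := Finite.exists_max fun j => |h x j|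
      exact mem_iUnion.2 ⟨i, x, ⟨hz, hi⟩, rfl⟩

theorem lsCategory_eq_krasnoselskiiGenus [Nonempty (sphere (0 : V) 1)]
    {A : Set (ProjectiveSpace V)} (hA : IsClosed A) :
    lsCategory A = krasnoselskiiGenus (antipodalMk ⁻¹' A) := by
  rw [krasnoselskiiGenus_eq (hA.preimage continuous_antipodalMk) (neg_mem_preimage_antipodalMk A)]
  exact iInf_congr fun m => iInf_congr_Prop (exists_cover_iff_oddNonvanishing hA m) fun _ => rfl

theorem hs_eq_kr [Nonempty (sphere (0 : V) 1)] (f : ProjectiveSpace V → ℝ) (k : ℕ) :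
    hs f k = kr (sphereLift f) k := by
  refine le_antisymm ?_ ?_
  · refine le_iInf fun B => le_iInf fun hB => le_iInf fun hneg => le_iInf fun hk => ?_
    refine (iInf_le_of_le (antipodalMk '' B) <| iInf₂_le_of_le (isClosed_image_antipodalMk hB hneg)
      ?_ ?_)
    · rwa [lsCategory_eq_krasnoselskiiGenus (isClosed_image_antipodalMk hB hneg),
        preimage_image_antipodalMk hneg]
    · rw [iSup_image]
      exact le_rfl
  · refine le_iInf fun A => le_iInf fun hA => le_iInf fun hk => ?_
    refine iInf_le_of_le (antipodalMk ⁻¹' A) <| iInf₂_le_of_le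
      (hA.preimage continuous_antipodalMk) (neg_mem_preimage_antipodalMk A) <| iInf_le_of_le
      (lsCategory_eq_krasnoselskiiGenus hA ▸ hk) ?_
    exact iSup₂_le fun x hx => le_iSup₂_of_le (antipodalMk x) hx le_rfl

end Category

/-! ### Borsuk-Ulam in dimension two -/

section BorsukUlam

/-- The Borsuk-Ulam theorem for the two-sphere. -/
theorem exists_eq_zero_of_odd (g : C(sphere (0 : EuclideanSpace ℝ (Fin 3)) 1, ℂ))
    (hodd : ∀ x, g (-x) = -g x) : ∃ x, g x = 0 := by
  by_contra! h0
  -- Normalised, this maps the plane to the sphere and the unit circle oddly to the equator. Over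
  -- the plane, `g` has a continuous logarithm `L`.
  let v : ℂ → EuclideanSpace ℝ (Fin 3) := fun u => !₂[u.re, u.im, 1 - ‖u‖ ^ 2]
  have hv0 : ∀ u, v u ≠ 0 := by
    intro u hu
    have hre : u.re = 0 := congrArg (fun w : EuclideanSpace ℝ (Fin 3) => w 0) hu
    have him : u.im = 0 := congrArg (fun w : EuclideanSpace ℝ (Fin 3) => w 1) hu
    have h2 : 1 - ‖u‖ ^ 2 = 0 := congrArg (fun w : EuclideanSpace ℝ (Fin 3) => w 2) hu
    have : u = 0 := Complex.ext hre him
    norm_num [this] at h2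
  have hvc : Continuous v := by
    have h3 : Continuous fun u : ℂ => (![u.re, u.im, 1 - ‖u‖ ^ 2] : Fin 3 → ℝ) := by
      refine continuous_pi fun i => ?_
      fin_cases i
      · exact Complex.continuous_re
      · exact Complex.continuous_im
      · exact continuous_const.sub (continuous_norm.pow 2)
    exact (PiLp.continuous_toLp 2 _).comp h3
  have hn : ∀ u, ‖v u‖ ≠ 0 := fun u => norm_ne_zero_iff.2 (hv0 u)
  have hmem : ∀ u, ‖v u‖⁻¹ • v u ∈ sphere (0 : EuclideanSpace ℝ (Fin 3)) 1 := fun u => by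
    simp [norm_smul, inv_mul_cancel₀ (hn u)]
  have hc : Continuous fun u => ‖v u‖⁻¹ • v u := (hvc.norm.inv₀ hn).smul hvc
  let φ : C(ℂ, sphere (0 : EuclideanSpace ℝ (Fin 3)) 1) := ⟨fun u => ⟨_, hmem u⟩,
    hc.subtype_mk hmem⟩
  have hφ : ∀ u : ℂ, ‖u‖ = 1 → φ (-u) = -φ u := by
    intro u hu
    have : v (-u) = -v u := by
      ext i
      fin_cases i <;> simp [v, hu]
    ext1
    simp [φ, this]
  let G : C(ℂ, {z : ℂ // z ≠ 0}) := ⟨fun u => ⟨g (φ u), h0 _⟩, by fun_prop⟩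
  obtain ⟨L, ⟨-, hL⟩, -⟩ := Complex.isCoveringMap_exp.existsUnique_continuousMap_lifts G 0
    (Complex.log (g (φ 0))) (Subtype.ext (Complex.exp_log (h0 _)))
  have hexp : ∀ u, Complex.exp (L u) = g (φ u) := fun u => congrArg Subtype.val (congrFun hL u)
  -- Oddness of `g` makes `D` an odd multiple of `πi`, constant by continuity; but half a turn swaps
  -- the two terms, so `D π = -D 0`, which is impossible.
  let D : ℝ → ℂ := fun θ => L (-Complex.exp (θ * Complex.I)) - L (Complex.exp (θ * Complex.I))
  have hD : Continuous D := by fun_prop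
  have hDexp : ∀ θ, Complex.exp (D θ) = -1 := by
    intro θ
    rw [Complex.exp_sub, hexp, hexp, hφ _ (Complex.norm_exp_ofReal_mul_I θ), hodd,
      neg_div, div_self (h0 _)]
  have hDint : ∀ θ, ∃ n : ℤ, D θ = (2 * n + 1) * (Real.pi * Complex.I) := by
    intro θ
    have : Complex.exp (D θ) = Complex.exp (Real.pi * Complex.I) := by
      rw [hDexp, Complex.exp_pi_mul_I]
    obtain ⟨n, hn⟩ := Complex.exp_eq_exp_iff_exists_int.1 this
    exact ⟨n, by rw [hn]; ring⟩
  choose n hn using hDint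
  have hπ : (Real.pi * Complex.I : ℂ) ≠ 0 := by simp [Real.pi_ne_zero]
  have hnc : Continuous n := by
    rw [Int.isClosedEmbedding_coe_real.isEmbedding.continuous_iff]
    have : (fun θ => (n θ : ℝ)) = fun θ => ((D θ / (Real.pi * Complex.I) - 1) / 2).re := by
      ext θ
      rw [hn, mul_div_cancel_right₀ _ hπ]
      simp
    change Continuous fun θ => (n θ : ℝ)
    rw [this]
    fun_prop
  have hconst : n Real.pi = n 0 := PreconnectedSpace.constant inferInstance hnc
  have hDπ : D Real.pi = -D 0 := by
    simp [D, Complex.exp_pi_mul_I]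
  rw [hn, hn, hconst, ← neg_mul] at hDπ
  have h4 := mul_right_cancel₀ hπ hDπ
  have h5 : (2 * n 0 + 1 : ℤ) = -(2 * n 0 + 1) := by exact_mod_cast h4
  omega

theorem not_oddNonvanishing_univ {m : ℕ} (hm : m < 3) :
    ¬ OddNonvanishing (univ : Set (sphere (0 : EuclideanSpace ℝ (Fin 3)) 1)) m := by
  rintro ⟨h, hodd, h0⟩
  have key : ∃ ℓ : C(EuclideanSpace ℝ (Fin m), ℂ), (∀ v, ℓ (-v) = -ℓ v) ∧
      ∀ v, ℓ v = 0 → v = 0 := by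
    interval_cases m
    · exact ⟨0, by simp, fun v _ => Subsingleton.elim _ _⟩
    · refine ⟨⟨fun v => (v 0 : ℂ), by fun_prop⟩, by simp, fun v hv => ?_⟩
      ext i
      rw [Subsingleton.elim i 0]
      simpa using hv
    · refine ⟨⟨fun v => (v 0 : ℂ) + v 1 * Complex.I, by fun_prop⟩, fun v => ?_, fun v hv => ?_⟩
      · simp
        ring
      · ext i
        fin_cases i
        · simpa using congrArg Complex.re hv
        · simpa using congrArg Complex.im hv
  obtain ⟨ℓ, hℓ, hℓ0⟩ := key
  obtain ⟨x, hx⟩ := exists_eq_zero_of_odd (ℓ.comp h) (by simp [hodd, hℓ])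
  exact h0 x (mem_univ _) (hℓ0 _ hx)

end BorsukUlam

/-! ### Min-max values and the genus of sublevel sets -/

section Sublevel

/-- On the compact zero set of the odd map, `g` has a minimum, which exceeds `a`; any `b` strictly
in between will do. -/
theorem OddNonvanishing.exists_gt {X : Type*} [TopologicalSpace X] [CompactSpace X] [Neg X]
    {g : X → ℝ} (hg : Continuous g) {a : ℝ} {m : ℕ} (h : OddNonvanishing {x | g x ≤ a} m) :
    ∃ b > a, OddNonvanishing {x | g x ≤ b} m := by
  obtain ⟨h, hodd, h0⟩ := h
  have hZ : IsCompact {x | h x = 0} := (isClosed_eq h.continuous continuous_const).isCompact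
  rcases eq_empty_or_nonempty {x | h x = 0} with hZe | hZe
  · exact ⟨a + 1, by linarith, h, hodd, fun x _ => eq_empty_iff_forall_notMem.1 hZe x⟩
  · obtain ⟨z, hz, hmin⟩ := hZ.exists_isMinOn hZe hg.continuousOn
    have haz : a < g z := not_le.1 fun hle => h0 z hle hz
    obtain ⟨b, hab, hbz⟩ := exists_between haz
    exact ⟨b, hab, h, hodd, fun x hx hx0 => not_lt.2 ((hmin hx0).trans hx) hbz⟩

variable {V : Type*} [NormedAddCommGroup V] [InnerProductSpace ℝ V] [FiniteDimensional ℝ V]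

/-- The min-max values are determined by the genus of the sublevel sets. -/
theorem kr_le_iff {g : sphere (0 : V) 1 → ℝ} (hg : Continuous g) (heven : ∀ x, g (-x) = g x)
    (k : ℕ) (a : ℝ) :
    kr g k ≤ a ↔ ∀ m < k, ¬ OddNonvanishing {x | g x ≤ a} m := by
  have hcl : ∀ a, IsClosed {x | g x ≤ a} := fun a => isClosed_le hg continuous_const
  have hneg : ∀ a, ∀ x ∈ {x | g x ≤ a}, -x ∈ {x | g x ≤ a} := by
    intro a x hx
    rwa [mem_ofPred_eq, heven]
  constructor
  · intro h m hm hodd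
    obtain ⟨b, hab, hb⟩ := hodd.exists_gt hg
    have hlt : kr g k < b := h.trans_lt (EReal.coe_lt_coe_iff.2 hab)
    simp only [kr, iInf_lt_iff] at hlt
    obtain ⟨A, hA, hAneg, hk, hsup⟩ := hlt
    refine (natCast_le_krasnoselskiiGenus_iff hA hAneg).1 hk m hm (hb.mono fun x hx => ?_)
    exact EReal.coe_le_coe_iff.1 ((le_iSup₂ (f := fun x _ => (g x : EReal)) x hx).trans hsup.le)
  · intro h
    refine iInf_le_of_le {x | g x ≤ a} <| iInf₂_le_of_le (hcl a) (hneg a) <| iInf_le_of_le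
      ((natCast_le_krasnoselskiiGenus_iff (hcl a) (hneg a)).2 h) ?_
    exact iSup₂_le fun x hx => EReal.coe_le_coe_iff.2 hx

end Sublevel

/-! ### Nontrivial loops in open sets of lines -/

section Cone

variable {V : Type*} [NormedAddCommGroup V] [NormedSpace ℝ V]

/-- The nonzero vectors whose line belongs to `U`. -/
def lineCone (U : Set (ProjectiveSpace V)) : Set V :=
  {v | ∃ h : v ≠ 0, projPoint ⟨v, h⟩ ∈ U}

theorem isOpen_lineCone {U : Set (ProjectiveSpace V)} (hU : IsOpen U) : IsOpen (lineCone U) := by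
  have : lineCone U = Subtype.val '' (projPoint ⁻¹' U : Set {v : V // v ≠ 0}) := by
    ext v
    simp [lineCone]
  rw [this]
  exact (isOpen_compl_singleton (x := (0 : V))).isOpenMap_subtype_val _
    (hU.preimage continuous_projPoint)

theorem smul_mem_lineCone {U : Set (ProjectiveSpace V)} {v : V} (hv : v ∈ lineCone U) {r : ℝ}
    (hr : r ≠ 0) : r • v ∈ lineCone U := by
  obtain ⟨h, hv⟩ := hv
  refine ⟨smul_ne_zero hr h, ?_⟩
  have h' : ‖v‖ ≠ 0 := norm_ne_zero_iff.2 h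
  rw [projPoint_eq_antipodalMk (x := ⟨‖v‖⁻¹ • v, by simp [norm_smul, inv_mul_cancel₀ h']⟩)
    (r * ‖v‖) (by simp [smul_smul, mul_assoc, mul_inv_cancel₀ h'])]
  exact hv

theorem neg_mem_lineCone {U : Set (ProjectiveSpace V)} {v : V} (hv : v ∈ lineCone U) :
    -v ∈ lineCone U := by
  simpa using smul_mem_lineCone hv (r := -1) (by norm_num)

theorem coe_mem_lineCone {U : Set (ProjectiveSpace V)} {x : sphere (0 : V) 1}
    (hx : antipodalMk x ∈ U) : (x : V) ∈ lineCone U :=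
  ⟨ne_zero_of_mem_unit_sphere x, by rwa [projPoint_eq_antipodalMk (x := x) 1 (by simp)]⟩

theorem JoinedIn.smul_lineCone {U : Set (ProjectiveSpace V)} {v w : V}
    (h : JoinedIn (lineCone U) v w) {r : ℝ} (hr : r ≠ 0) :
    JoinedIn (lineCone U) (r • v) (r • w) := by
  obtain ⟨γ, hγ⟩ := h
  exact ⟨γ.map (continuous_const_smul r), fun t => smul_mem_lineCone (hγ t) hr⟩

theorem JoinedIn.neg_lineCone {U : Set (ProjectiveSpace V)} {v w : V}
    (h : JoinedIn (lineCone U) v w) : JoinedIn (lineCone U) (-v) (-w) := by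
  simpa using h.smul_lineCone (r := -1) (by norm_num)

/-- If no vector of the cone over `U` is joined to its negative, then `U` has genus at most one. -/
theorem exists_joinedIn_neg {U : Set (ProjectiveSpace V)} (hU : IsOpen U)
    {B : Set (sphere (0 : V) 1)} (hB : IsClosed B) (hneg : ∀ x ∈ B, -x ∈ B)
    (hBU : ∀ x ∈ B, antipodalMk x ∈ U) (hB1 : ¬ OddNonvanishing B 1) :
    ∃ v, JoinedIn (lineCone U) v (-v) := by
  classical
  by_contra! hno
  let P : V → Set V := pathComponentIn (lineCone U)
  have hP : ∀ v w, JoinedIn (lineCone U) v w → P v = P w := fun v w h => by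
    ext u
    exact ⟨fun hu => h.symm.trans hu, fun hu => h.trans hu⟩
  have hne : ∀ v ∈ lineCone U, P v ≠ P (-v) := by
    intro v hv h
    refine hno v ?_
    have : -v ∈ P (-v) := mem_pathComponentIn_self (neg_mem_lineCone hv)
    rwa [← h] at this
  -- If `v` and `-v` always lie in different path components, a well-order on sets of vectors
  -- chooses one of the two, which gives an odd, locally constant sign.
  let s : V → ℝ := fun v => if WellOrderingRel (P v) (P (-v)) then 1 else -1
  have hs : ∀ x : B, s (x : sphere (0 : V) 1) ≠ 0 := by
    intro x
    dsimp only [s]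
    split_ifs <;> norm_num
  have hsodd : ∀ v ∈ lineCone U, s (-v) = -s v := by
    intro v hv
    dsimp only [s]
    rw [neg_neg]
    rcases trichotomous_of (WellOrderingRel : Set V → Set V → Prop) (P v) (P (-v)) with h | h | h
    · rw [if_pos h, if_neg (asymm_of _ h)]
    · exact absurd h (hne v hv)
    · rw [if_pos h, if_neg (asymm_of _ h), neg_neg]
  have hsc : Continuous fun x : B => s (x : sphere (0 : V) 1) := by
    refine IsLocallyConstant.continuous ((IsLocallyConstant.iff_exists_open _).2 fun x => ?_)
    have hx := coe_mem_lineCone (hBU x x.2)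
    obtain ⟨ε, hε, hball⟩ := Metric.isOpen_iff.1 (isOpen_lineCone hU) _ hx
    refine ⟨(fun y : B => ((y : sphere (0 : V) 1) : V)) ⁻¹' ball (x : V) ε,
      isOpen_ball.preimage (by fun_prop), mem_ball_self hε, fun y hy => ?_⟩
    have hj : JoinedIn (lineCone U) (y : V) (x : V) :=
      JoinedIn.of_segment_subset
        (((convex_ball (x : V) ε).segment_subset hy (mem_ball_self hε)).trans hball)
    simp only [s, hP _ _ hj, hP _ _ hj.neg_lineCone]
  refine hB1 (.of_continuousMap hB hneg ⟨fun x => WithLp.toLp 2 fun _ => s x,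
    (PiLp.continuous_toLp 2 _).comp (continuous_pi fun _ => hsc)⟩ ?_ ?_)
  · intro x y h
    ext i
    simp [h, hsodd _ (coe_mem_lineCone (hBU x x.2))]
  · intro x hx
    exact hs x (congrArg (fun v : EuclideanSpace ℝ (Fin 1) => v 0) hx)

/-- The functional changes sign between `v` and `-v`, so it vanishes at some `z` on the path. From
`z` go back to `v`, on to `-v`, then along the negated path to `-z`. This makes the base point of
the loop orthogonal to a given vector. -/
theorem exists_joinedIn_neg_of_linear {U : Set (ProjectiveSpace V)} {v : V}
    (h : JoinedIn (lineCone U) v (-v)) (ℓ : V →L[ℝ] ℝ) :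
    ∃ z, ‖z‖ = 1 ∧ ℓ z = 0 ∧ JoinedIn (lineCone U) z (-z) := by
  obtain ⟨z, hz0, hz⟩ : ∃ z, ℓ z = 0 ∧ JoinedIn (lineCone U) z (-z) := by
    have h' := h
    obtain ⟨γ, hγ⟩ := h'
    have hc : Continuous fun t => ℓ (γ t) := by fun_prop
    have h0 : (0 : ℝ) ∈ range fun t => ℓ (γ t) := by
      rcases le_total (ℓ v) 0 with hv | hv
      · exact mem_range_of_exists_le_of_exists_ge hc ⟨0, by simpa using hv⟩ ⟨1, by simpa using hv⟩
      · exact mem_range_of_exists_le_of_exists_ge hc ⟨1, by simpa using hv⟩ ⟨0, by simpa using hv⟩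
    obtain ⟨t, ht⟩ := h0
    have hvt : JoinedIn (lineCone U) v (γ t) :=
      JoinedIn.ofLine (f := fun s : ℝ => γ.extend (s * t))
        (by fun_prop) (by simp) (by simp) (by
          rintro _ ⟨s, hs, rfl⟩
          exact hγ _)
    exact ⟨γ t, ht, hvt.symm.trans (h.trans hvt.neg_lineCone)⟩
  have hz1 : ‖z‖ ≠ 0 := norm_ne_zero_iff.2 hz.mem.1.1
  refine ⟨‖z‖⁻¹ • z, by simp [norm_smul, inv_mul_cancel₀ hz1], by simp [hz0], ?_⟩
  simpa using hz.smul_lineCone (inv_ne_zero hz1)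

end Cone

/-! ### Smoothing paths and homotopies avoiding the origin -/

section Paths

/-- A path in an open set can be replaced by a smooth one. -/
theorem JoinedIn.exists_contDiff {V : Type*} [NormedAddCommGroup V] [NormedSpace ℝ V]
    {C : Set V} (hC : IsOpen C) {v w : V} (h : JoinedIn C v w) :
    ∃ α : ℝ → V, ContDiff ℝ 1 α ∧ α 0 = v ∧ α 1 = w ∧ ∀ s ∈ I, α s ∈ C := by
  obtain ⟨γ, hγ⟩ := h
  obtain ⟨ε, hε, hthick⟩ := (isCompact_range γ.continuous).exists_thickening_subset_open hC
    (range_subset_iff.2 hγ)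
  obtain ⟨n, hn, hn0⟩ := (((Metric.tendsto_nhds.1
    (bernsteinApproximation_uniform (γ : C(I, V)))) ε hε).and
    (Filter.eventually_ne_atTop 0)).exists
  -- The Bernstein polynomial of the path: uniformly close to it, and with exactly the same ends
  -- when `n ≠ 0`.
  let α : ℝ → V := fun s => ∑ k : Fin (n + 1),
    ((bernsteinPolynomial ℝ n k).eval s) • γ (bernstein.z k)
  have hα : ∀ s : I, α s = bernsteinApproximation n (γ : C(I, V)) s := by
    intro s
    rw [bernsteinApproximation.apply]
    rfl
  refine ⟨α, ?_, ?_, ?_, fun s hs => hthick ?_⟩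
  · refine ContDiff.sum fun k _ => ContDiff.smul ?_ contDiff_const
    simpa using Polynomial.contDiff_aeval (𝕜 := ℝ) (R := ℝ) (bernsteinPolynomial ℝ n k) 1
  · simpa using (hα 0).trans (bernsteinApproximation.apply_zero n _)
  · simpa using (hα 1).trans (bernsteinApproximation.apply_one hn0 _)
  · refine mem_thickening_iff.2 ⟨γ ⟨s, hs⟩, mem_range_self _, ?_⟩
    rw [hα ⟨s, hs⟩]
    exact (ContinuousMap.dist_apply_le_dist _).trans_lt hn

/-- In dimension at least three, two smooth paths with the same ends that avoid the origin are
homotopic in the complement of the origin. -/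
theorem exists_homotopy_ne_zero {V : Type*} [NormedAddCommGroup V] [NormedSpace ℝ V]
    [FiniteDimensional ℝ V] (hV : 2 < Module.finrank ℝ V) {α β : ℝ → V}
    (hα : ContDiff ℝ 1 α) (hβ : ContDiff ℝ 1 β) (hα0 : ∀ s ∈ I, α s ≠ 0)
    (hβ0 : ∀ s ∈ I, β s ≠ 0) (h0 : α 0 = β 0) (h1 : α 1 = β 1) :
    ∃ G : ℝ × ℝ → V, Continuous G ∧ (∀ s ∈ I, ∀ t ∈ I, G (s, t) ≠ 0) ∧
      (∀ s, G (s, 0) = β s) ∧ (∀ s, G (s, 1) = α s) ∧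
      (∀ t, G (0, t) = β 0) ∧ ∀ t, G (1, t) = β 1 := by
  -- The linear homotopy is perturbed by `κ • w`, where `κ` vanishes on the sides of the square and
  -- so leaves both paths and their ends fixed.
  let κ : ℝ × ℝ → ℝ := fun z => z.2 * (1 - z.2) * (z.1 * (1 - z.1))
  let lin : ℝ × ℝ → V := fun z => (1 - z.2) • β z.1 + z.2 • α z.1
  let J : Set (ℝ × ℝ) := Ioo 0 1 ×ˢ Ioo 0 1
  have hκ : ∀ z ∈ J, κ z ≠ 0 := by
    rintro ⟨s, t⟩ ⟨⟨hs, hs'⟩, ht, ht'⟩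
    have : 0 < κ (s, t) :=
      mul_pos (mul_pos ht (sub_pos.2 ht')) (mul_pos hs (sub_pos.2 hs'))
    exact this.ne'
  have hlin : ContDiff ℝ 1 lin :=
    ((contDiff_const.sub contDiff_snd).smul (hβ.comp contDiff_fst)).add
      (contDiff_snd.smul (hα.comp contDiff_fst))
  have hκc : ContDiff ℝ 1 κ := by fun_prop
  have hsm : ContDiffOn ℝ 1 (fun z => -((κ z)⁻¹ • lin z)) J :=
    ((hκc.contDiffOn.inv hκ).smul hlin.contDiffOn).neg
  -- The bad vectors `w` form a `C^1` image of a plane set, of dimension at most two, hence they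
  -- miss some vector of `V`.
  have hdense : Dense ((fun z => -((κ z)⁻¹ • lin z)) '' J)ᶜ := by
    refine hsm.dense_compl_image_of_dimH_lt_finrank ((convex_Ioo 0 1).prod (convex_Ioo 0 1))
      le_rfl ((dimH_mono (subset_univ J)).trans_lt ?_)
    rw [Real.dimH_univ_eq_finrank]
    simpa using hV
  obtain ⟨w, hw⟩ := hdense.nonempty
  refine ⟨fun z => lin z + κ z • w, hlin.continuous.add (hκc.continuous.smul continuous_const),
    fun s hs t ht hz => ?_, fun s => ?_, fun s => ?_, fun t => ?_, fun t => ?_⟩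
  · by_cases hJ : (s, t) ∈ J
    · refine hw ⟨(s, t), hJ, ?_⟩
      simp only
      rw [eq_neg_of_add_eq_zero_left hz, smul_neg, neg_neg, smul_smul, inv_mul_cancel₀ (hκ _ hJ),
        one_smul]
    · have hcases : s = 0 ∨ s = 1 ∨ t = 0 ∨ t = 1 := by
        by_contra! hc
        exact hJ ⟨⟨hs.1.lt_of_ne' hc.1, hs.2.lt_of_ne hc.2.1⟩,
          ht.1.lt_of_ne' hc.2.2.1, ht.2.lt_of_ne hc.2.2.2⟩
      rcases hcases with rfl | rfl | rfl | rfl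
      · refine hβ0 0 hs ?_
        simpa [lin, κ, h0, ← add_smul] using hz
      · refine hβ0 1 hs ?_
        simpa [lin, κ, h1, ← add_smul] using hz
      · exact hβ0 s hs (by simpa [lin, κ] using hz)
      · exact hα0 s hs (by simpa [lin, κ] using hz)
  · simp [lin, κ]
  · simp [lin, κ]
  · simp [lin, κ, h0, ← add_smul]
  · simp [lin, κ, h1, ← add_smul]

end Paths

/-! ### Deforming a proper subset of the projective plane onto a loop -/

section Deformation

theorem exists_concat {X Y : Type*} [TopologicalSpace X] [TopologicalSpace Y]
    (H₁ H₂ : C(X × I, Y)) (h : ∀ x, H₁ (x, 1) = H₂ (x, 0)) :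
    ∃ H : C(X × I, Y), (∀ x, H (x, 0) = H₁ (x, 0)) ∧ ∀ x, H (x, 1) = H₂ (x, 1) := by
  let e : ∀ t : I, C(X, X × I) := fun t => ⟨fun x => (x, t), by fun_prop⟩
  let G₁ : (H₁.comp (e 0)).Homotopy (H₁.comp (e 1)) :=
    ⟨H₁.comp ContinuousMap.prodSwap, fun _ => rfl, fun _ => rfl⟩
  let G₂ : (H₁.comp (e 1)).Homotopy (H₂.comp (e 1)) :=
    ⟨H₂.comp ContinuousMap.prodSwap, fun x => (h x).symm, fun _ => rfl⟩
  exact ⟨(G₁.trans G₂).toContinuousMap.comp ContinuousMap.prodSwap,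
    fun x => (G₁.trans G₂).apply_zero x, fun x => (G₁.trans G₂).apply_one x⟩

variable {V : Type*} [NormedAddCommGroup V] [InnerProductSpace ℝ V] [FiniteDimensional ℝ V]

/-- A proper subset of the projective plane can be deformed into any open set that contains a
nontrivial loop. -/
theorem exists_deformation_of_joinedIn (hV : Module.finrank ℝ V = 3)
    {K U : Set (ProjectiveSpace V)} (hU : IsOpen U) {p : sphere (0 : V) 1}
    (hp : antipodalMk p ∉ K) {z : V} (hz : ‖z‖ = 1) (hpz : ⟪(p : V), z⟫ = 0)
    (h : JoinedIn (lineCone U) z (-z)) :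
    ∃ H : C(K × I, ProjectiveSpace V), (∀ x, H (x, 0) = x) ∧ ∀ x, H (x, 1) ∈ U := by
  obtain ⟨b, hb0, hb2⟩ : ∃ b : OrthonormalBasis (Fin 3) ℝ V, b 0 = z ∧ b 2 = p := by
    have hp1 : ‖(p : V)‖ = 1 := norm_eq_of_mem_sphere p
    obtain ⟨b, hb⟩ := Orthonormal.exists_orthonormalBasis_extension_of_card_eq (𝕜 := ℝ)
      (ι := Fin 3) (by simpa using hV) (v := ![z, 0, (p : V)]) (s := {0, 2}) (by
        rw [orthonormal_iff_ite]
        rintro ⟨i, hi⟩ ⟨j, hj⟩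
        rcases hi with rfl | hi <;> rcases hj with rfl | hj
        · simp [hz]
        · obtain rfl : j = 2 := hj
          simp [real_inner_comm z (p : V) ▸ hpz, Subtype.ext_iff]
        · obtain rfl : i = 2 := hi
          simp [hpz, Subtype.ext_iff]
        · obtain rfl : j = 2 := hj
          obtain rfl : i = 2 := hi
          simp)
    exact ⟨b, hb 0 (by simp), hb 2 (by simp)⟩
  have hbi : ∀ i j, ⟪b i, b j⟫ = if i = j then (1 : ℝ) else 0 := orthonormal_iff_ite.1 b.orthonormal
  obtain ⟨α, hα, hα0, hα1, hαC⟩ := h.exists_contDiff (isOpen_lineCone hU)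
  -- A parabolic arc from `z = b 0` to `-z` in the plane orthogonal to `p`: it represents the
  -- projective line opposite to `[p]`. Its `b 0`-coordinate is affine in `s`, so a cosine `c` is
  -- reached at `s = (1 - c) / 2`.
  let β : ℝ → V := fun s => (1 - 2 * s) • b 0 + (s * (1 - s)) • b 1
  have hβc : ContDiff ℝ 1 β := by fun_prop
  have hβin0 : ∀ s, ⟪b 0, β s⟫ = 1 - 2 * s := by
    intro s
    simp [β, inner_add_right, real_inner_smul_right, hbi]
  have hβin1 : ∀ s, ⟪b 1, β s⟫ = s * (1 - s) := by
    intro s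
    simp [β, inner_add_right, real_inner_smul_right, hbi]
  have hβ0 : ∀ s ∈ I, β s ≠ 0 := by
    intro s _ hs
    have h0 := hβin0 s
    have h1 := hβin1 s
    rw [hs, inner_zero_right] at h0 h1
    obtain rfl : s = 1 / 2 := by linarith
    norm_num at h1
  obtain ⟨G, hGc, hG0, hGβ, hGα, hGl, hGr⟩ := exists_homotopy_ne_zero (by omega) hα hβc
    (fun s hs => (hαC s hs).1) hβ0 (by simp [hα0, β, hb0]) (by simp [hα1, β, hb0]; norm_num)
  have hGlr : ∀ t, G (1, t) = -G (0, t) := by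
    intro t
    rw [hGl, hGr]
    simp [β]
    norm_num
  let B : Set (sphere (0 : V) 1) := antipodalMk ⁻¹' K
  let d : B → ℝ := fun y => ⟪b 1, (y : V)⟫
  let r : B → ℝ := fun y => √(⟪b 0, (y : V)⟫ ^ 2 + ⟪b 1, (y : V)⟫ ^ 2)
  let c : B → ℝ := fun y => ⟪b 0, (y : V)⟫ / r y
  have hr : ∀ y, 0 < r y := by
    intro y
    refine Real.sqrt_pos.2 (lt_of_le_of_ne (by positivity) fun h0 => hp ?_)
    have h00 : ⟪b 0, (y : V)⟫ = 0 := by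
      nlinarith [sq_nonneg ⟪b 0, (y : V)⟫, sq_nonneg ⟪b 1, (y : V)⟫]
    have h01 : ⟪b 1, (y : V)⟫ = 0 := by
      nlinarith [sq_nonneg ⟪b 0, (y : V)⟫, sq_nonneg ⟪b 1, (y : V)⟫]
    have hy := b.sum_repr' (y : V)
    simp only [Fin.sum_univ_three, h00, h01, zero_smul, zero_add, hb2] at hy
    have : antipodalMk (y : sphere (0 : V) 1) = antipodalMk p := by
      rw [← projPoint_eq_antipodalMk (v := ⟨(y : V), ne_zero_of_mem_unit_sphere y.1⟩)
        ⟪(p : V), (y : V)⟫ hy.symm, projPoint_eq_antipodalMk (x := y) 1 (by simp)]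
    rw [← this]
    exact y.2
  have hrc : Continuous r := by fun_prop
  have hcc : Continuous c := by
    have : Continuous fun y : B => ⟪b 0, (y : V)⟫ := by fun_prop
    exact this.div hrc fun y => (hr y).ne'
  have hdc : Continuous d := by fun_prop
  have hc1 : ∀ y, c y ^ 2 ≤ 1 := by
    intro y
    rw [div_pow, Real.sq_sqrt (by positivity)]
    exact div_le_one_of_le₀ (by nlinarith [sq_nonneg ⟪b 1, (y : V)⟫]) (by positivity)
  have hcd : ∀ y, d y = 0 → c y = 1 ∨ c y = -1 := by
    intro y hy
    have h1 : ⟪b 0, (y : V)⟫ ≠ 0 := by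
      intro h0
      have := hr y
      simp only [r, h0, show ⟪b 1, (y : V)⟫ = 0 from hy] at this
      norm_num at this
    have : c y ^ 2 = 1 := by
      rw [div_pow, Real.sq_sqrt (by positivity), show ⟪b 1, (y : V)⟫ = 0 from hy]
      field_simp
      ring
    exact sq_eq_one_iff.1 this
  have hsI : ∀ y, (1 - c y) / 2 ∈ I ∧ (1 + c y) / 2 ∈ I := by
    intro y
    obtain ⟨h1, h2⟩ := abs_le.1 ((sq_le_one_iff_abs_le_one _).1 (hc1 y))
    constructor <;> constructor <;> linarith
  -- At time 0 this is the point of the arc, or of its negative, with the same `b 0`-cosine as the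
  -- projection of `y` and on the same side. The two formulas agree at `d = 0` because `c = ±1`
  -- there and the ends of `G` are antipodal.
  let Γ : B × I → V := fun w =>
    if 0 ≤ d w.1 then G ((1 - c w.1) / 2, w.2) else -G ((1 + c w.1) / 2, w.2)
  have hagree : ∀ y (t : ℝ), d y = 0 → G ((1 - c y) / 2, t) = -G ((1 + c y) / 2, t) := by
    intro y t hy
    rcases hcd y hy with h | h <;> rw [h] <;> norm_num [hGlr]
  have hΓc : Continuous Γ := by
    refine Continuous.if_le (by fun_prop) (by fun_prop) continuous_const (by fun_prop) ?_
    intro w hw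
    exact hagree w.1 w.2 hw.symm
  have hcneg : ∀ x y : B, (y : sphere (0 : V) 1) = -x → c y = -c x ∧ d y = -d x := by
    intro x y hxy
    simp [c, d, r, hxy, neg_div]
  have hΓodd : ∀ (x y : B) (t : I), (y : sphere (0 : V) 1) = -x → Γ (y, t) = -Γ (x, t) := by
    intro x y t hxy
    obtain ⟨h1, h2⟩ := hcneg x y hxy
    simp only [Γ, h1, h2]
    rcases lt_trichotomy (d x) 0 with hd | hd | hd
    · rw [if_pos (by linarith), if_neg (by linarith), sub_neg_eq_add, neg_neg]
    · rw [if_pos (by linarith), if_pos (by linarith), hagree x t hd, sub_neg_eq_add, neg_neg]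
    · rw [if_neg (by linarith), if_pos (by linarith), ← sub_eq_add_neg]
  have hΓ0 : ∀ w, Γ w ≠ 0 := by
    rintro ⟨y, t⟩
    dsimp only [Γ]
    split_ifs
    · exact hG0 _ (hsI y).1 _ t.2
    · exact neg_ne_zero.2 (hG0 _ (hsI y).2 _ t.2)
  have hΓin0 : ∀ y, ⟪b 0, Γ (y, 0)⟫ = c y := by
    intro y
    dsimp only [Γ]
    split_ifs
    · rw [Icc.coe_zero, hGβ, hβin0]
      ring
    · rw [Icc.coe_zero, hGβ, inner_neg_right, hβin0]
      ring
  let F : C(B × I, V) := ⟨fun w => (1 - (w.2 : ℝ)) • (w.1 : V) + (w.2 : ℝ) • Γ (w.1, 0), by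
    have : Continuous fun w : B × I => Γ (w.1, 0) := hΓc.comp (by fun_prop)
    fun_prop⟩
  -- The `b 0`-coordinate of `F` is `c * ((1 - t) * r + t)`, so a zero needs `c = 0`; then `Γ` is
  -- the midpoint of its arc, with `b 1`-coordinate `±1/4` of the same sign as `d`, and nothing
  -- cancels.
  have hF0 : ∀ w, F w ≠ 0 := by
    rintro ⟨y, t⟩ hw
    have hin : ∀ i, (1 - (t : ℝ)) * ⟪b i, (y : V)⟫ + t * ⟪b i, Γ (y, 0)⟫ = 0 := by
      intro i
      have := congrArg (fun v => ⟪b i, v⟫) hw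
      simpa [F, inner_add_right, real_inner_smul_right] using this
    have ht0 : (0 : ℝ) ≤ t := t.2.1
    have ht1 : (t : ℝ) ≤ 1 := t.2.2
    have hpos : 0 < (1 - (t : ℝ)) * r y + t := by
      rcases ht1.eq_or_lt with h | h
      · rw [h]
        norm_num
      · have := mul_pos (sub_pos.2 h) (hr y)
        linarith
    have hcr : ⟪b 0, (y : V)⟫ = c y * r y := (div_mul_cancel₀ _ (hr y).ne').symm
    have hc0 : c y = 0 := by
      have := hin 0
      rw [hΓin0, hcr] at this
      have h' : c y * ((1 - (t : ℝ)) * r y + t) = 0 := by linarith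
      exact (mul_eq_zero.1 h').resolve_right hpos.ne'
    have hd0 : d y ≠ 0 := by
      intro hd
      rcases hcd y hd with h | h <;> rw [hc0] at h <;> norm_num at h
    have h1 : (1 - (t : ℝ)) * d y + t * ⟪b 1, Γ (y, 0)⟫ = 0 := hin 1
    rcases hd0.lt_or_gt with hd | hd
    · have : ⟪b 1, Γ (y, 0)⟫ = -(1 / 4) := by
        simp only [Γ, if_neg (not_le.2 hd), Icc.coe_zero, hGβ, inner_neg_right, hβin1, hc0]
        norm_num
      rw [this] at h1
      rcases ht0.eq_or_lt with h | h
      · rw [← h] at h1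
        linarith
      · nlinarith [mul_nonneg (sub_nonneg.2 ht1) (neg_nonneg.2 hd.le)]
    · have : ⟪b 1, Γ (y, 0)⟫ = 1 / 4 := by
        simp only [Γ, if_pos hd.le, Icc.coe_zero, hGβ, hβin1, hc0]
        norm_num
      rw [this] at h1
      rcases ht0.eq_or_lt with h | h
      · rw [← h] at h1
        linarith
      · nlinarith [mul_nonneg (sub_nonneg.2 ht1) hd.le]
  obtain ⟨H₁, hH₁⟩ := exists_descent F hF0 (by
    intro x y t hxy
    simp only [F, ContinuousMap.coe_mk, hΓodd x y 0 hxy, hxy, coe_neg_sphere, smul_neg]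
    abel)
  obtain ⟨H₂, hH₂⟩ := exists_descent ⟨Γ, hΓc⟩ hΓ0 hΓodd
  have hsurj := (isOpenQuotientMap_antipodalMk.restrictPreimage K).surjective
  -- Retract to the projective line, then follow `G` from `β` to the path `α` in the cone over `U`.
  obtain ⟨H, hH0, hH1⟩ := exists_concat H₁ H₂ (by
    intro x
    obtain ⟨y, rfl⟩ := hsurj x
    rw [hH₁, hH₂]
    congr 1
    ext1
    simp [F])
  refine ⟨H, fun x => ?_, fun x => ?_⟩
  · obtain ⟨y, rfl⟩ := hsurj x
    rw [hH0, hH₁]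
    exact projPoint_eq_antipodalMk 1 (by simp [F])
  · obtain ⟨y, rfl⟩ := hsurj x
    rw [hH1, hH₂]
    have hmem : Γ (y, 1) ∈ lineCone U := by
      dsimp only [Γ]
      rw [Icc.coe_one, hGα, hGα]
      split_ifs
      · exact hαC _ (hsI y).1
      · exact neg_mem_lineCone (hαC _ (hsI y).2)
    exact hmem.2

theorem exists_deformation_of_not_oddNonvanishing (hV : Module.finrank ℝ V = 3)
    {K U : Set (ProjectiveSpace V)} (hU : IsOpen U) (hK : K ≠ univ)
    {B : Set (sphere (0 : V) 1)} (hB : IsClosed B) (hneg : ∀ x ∈ B, -x ∈ B)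
    (hBU : ∀ x ∈ B, antipodalMk x ∈ U) (hB1 : ¬ OddNonvanishing B 1) :
    ∃ H : C(K × I, ProjectiveSpace V), (∀ x, H (x, 0) = x) ∧ ∀ x, H (x, 1) ∈ U := by
  obtain ⟨q, hq⟩ := (ne_univ_iff_exists_notMem K).1 hK
  obtain ⟨p, rfl⟩ := antipodalMk_surjective q
  obtain ⟨v, hv⟩ := exists_joinedIn_neg hU hB hneg hBU hB1
  obtain ⟨z, hz1, hz0, hz⟩ := exists_joinedIn_neg_of_linear hv (innerSL ℝ (p : V))
  exact exists_deformation_of_joinedIn hV hU hq hz1 hz0 hz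

end Deformation

/-! ### Comparison of the spectra -/

section Spectrum

variable {V : Type*} [NormedAddCommGroup V] [InnerProductSpace ℝ V]

/-- Orthogonal projection along `p` to its `n`-dimensional complement vanishes on the sphere only at
`±p`. -/
theorem oddNonvanishing_of_notMem {n : ℕ} [Fact (Module.finrank ℝ V = n + 1)]
    {A : Set (ProjectiveSpace V)} {q : ProjectiveSpace V} (hq : q ∉ A) :
    OddNonvanishing (antipodalMk ⁻¹' A) n := by
  obtain ⟨p, rfl⟩ := antipodalMk_surjective q
  have hp0 : (p : V) ≠ 0 := ne_zero_of_mem_unit_sphere p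
  let b := OrthonormalBasis.fromOrthogonalSpanSingleton (𝕜 := ℝ) n hp0
  refine ⟨⟨fun x => b.repr ((ℝ ∙ (p : V))ᗮ.orthogonalProjectionOnto (x : V)), ?_⟩, ?_, ?_⟩
  · exact b.repr.continuous.comp
      (((ℝ ∙ (p : V))ᗮ.orthogonalProjectionOnto).continuous.comp continuous_subtype_val)
  · intro x
    simp
  · intro x hx h0
    have h0' : (ℝ ∙ (p : V))ᗮ.orthogonalProjectionOnto (x : V) = 0 := by simpa using h0
    rw [Submodule.orthogonalProjectionOnto_eq_zero_iff, Submodule.orthogonal_orthogonal] at h0'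
    obtain ⟨r, hr⟩ := Submodule.mem_span_singleton.1 h0'
    refine hq ?_
    have : antipodalMk x = antipodalMk p := by
      rw [← projPoint_eq_antipodalMk (v := ⟨(x : V), ne_zero_of_mem_unit_sphere x⟩) (x := p) r
        hr.symm, projPoint_eq_antipodalMk (x := x) 1 (by simp)]
    rw [← this]
    exact hx

theorem continuous_sphereLift {f : ProjectiveSpace V → ℝ} (hf : Continuous f) :
    Continuous (sphereLift f) :=
  hf.comp continuous_antipodalMk

theorem sphereLift_neg (f : ProjectiveSpace V → ℝ) (x : sphere (0 : V) 1) :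
    sphereLift f (-x) = sphereLift f x :=
  congrArg f (antipodalMk_neg x)

variable [FiniteDimensional ℝ V]

/-- Every min-max value belongs to the homotopy significant spectrum. -/
theorem mem_homotopySignificantSpectrum_of_kr_eq {f : ProjectiveSpace V → ℝ} (hf : Continuous f)
    {k : ℕ} {a : ℝ} (ha : kr (sphereLift f) k = a) :
    a ∈ homotopySignificantSpectrum f := by
  rintro ⟨H, H0, H1⟩
  have hg := continuous_sphereLift hf
  have hle := kr_le_iff hg (sphereLift_neg f) k
  let K : Set (ProjectiveSpace V) := {x | f x ≤ a}
  have hK : IsClosed K := isClosed_le hf continuous_const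
  have hKB : IsClosed (antipodalMk ⁻¹' K : Set (sphere (0 : V) 1)) :=
    hK.preimage continuous_antipodalMk
  have hKneg := neg_mem_preimage_antipodalMk K
  obtain ⟨u, hodd, hu⟩ := exists_odd_lift hK (H : C(K × I, ProjectiveSpace V)) H0
  have hu0 : ∀ x, u x ≠ 0 := by
    intro x
    obtain ⟨y, -, r, hr, h⟩ := hu x
    rw [h]
    exact smul_ne_zero hr (ne_zero_of_mem_unit_sphere y)
  have hn : ∀ x, ‖u x‖ ≠ 0 := fun x => norm_ne_zero_iff.2 (hu0 x)
  have hmem : ∀ x, ‖u x‖⁻¹ • u x ∈ sphere (0 : V) 1 := fun x => by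
    simp [norm_smul, inv_mul_cancel₀ (hn x)]
  have hc : Continuous fun x => ‖u x‖⁻¹ • u x := (u.continuous.norm.inv₀ hn).smul u.continuous
  let e : C((antipodalMk ⁻¹' K : Set (sphere (0 : V) 1)), sphere (0 : V) 1) :=
    ⟨fun x => ⟨_, hmem x⟩, hc.subtype_mk hmem⟩
  have heodd : ∀ x y : (antipodalMk ⁻¹' K : Set (sphere (0 : V) 1)),
      (y : sphere (0 : V) 1) = -x → e y = -e x := by
    intro x y h
    ext1
    simp [e, hodd x y h]
  have he : ∀ x, sphereLift f (e x) < a := by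
    intro x
    obtain ⟨y, hy, r, -, h⟩ := hu x
    have h1 : antipodalMk (e x) = antipodalMk y :=
      projPoint_eq_antipodalMk (v := ⟨u x, hu0 x⟩) r h
    change f (antipodalMk (e x)) < a
    rw [h1, hy]
    exact H1 _
  have hSa : ∀ m < k, ¬ OddNonvanishing {x | sphereLift f x ≤ a} m := (hle a).1 ha.le
  have : CompactSpace (antipodalMk ⁻¹' K : Set (sphere (0 : V) 1)) :=
    isCompact_iff_compactSpace.1 hKB.isCompact
  -- Compactness turns the pointwise strict inequality into a uniform one; composing with `e` then
  -- carries odd maps on `{f̃ ≤ b}` back to `{f̃ ≤ a}`.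
  obtain ⟨b, hba, hb⟩ : ∃ b < a, ∀ x, sphereLift f (e x) ≤ b := by
    rcases isEmpty_or_nonempty (antipodalMk ⁻¹' K : Set (sphere (0 : V) 1)) with h | h
    · exact ⟨a - 1, by linarith, fun x => h.elim x⟩
    · obtain ⟨z, -, hz⟩ := isCompact_univ.exists_isMaxOn (univ_nonempty)
        (hg.comp e.continuous).continuousOn
      exact ⟨_, he z, fun x => hz (mem_univ x)⟩
  have hkb : kr (sphereLift f) k ≤ b := by
    refine (hle b).2 fun m hm hb' => hSa m hm ?_
    obtain ⟨h, h1, h2⟩ := hb'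
    exact .of_continuousMap hKB hKneg (h.comp e) (fun x y hxy => by simp [heodd x y hxy, h1])
      fun x => h2 _ (hb x)
  rw [ha] at hkb
  exact absurd (EReal.coe_le_coe_iff.1 hkb) (not_le.2 hba)

/-- Every homotopy significant value of a function on the projective plane is a min-max value. -/
theorem exists_kr_eq_of_mem_homotopySignificantSpectrum
    {f : RP 2 → ℝ} (hf : Continuous f) {a : ℝ} (ha : a ∈ homotopySignificantSpectrum f) :
    kr (sphereLift f) 1 = a ∨ kr (sphereLift f) 2 = a ∨ kr (sphereLift f) 3 = a := by
  by_contra! hne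
  obtain ⟨h1, h2, h3⟩ := hne
  refine ha ?_
  have hg := continuous_sphereLift hf
  have hle := kr_le_iff hg (sphereLift_neg f)
  -- Genus at least `k` at level `a` means `kr_k ≤ a`; as equality is excluded, the same genus is
  -- already reached at a lower level `b`.
  have hlt : ∀ k : ℕ, kr (sphereLift f) k ≠ a →
      (∀ m < k, ¬ OddNonvanishing {x | sphereLift f x ≤ a} m) →
      ∃ b < a, ∀ m < k, ¬ OddNonvanishing {x | sphereLift f x ≤ b} m := by
    intro k hk h
    obtain ⟨b, hb1, hb2⟩ := EReal.lt_iff_exists_real_btwn.1 (((hle k a).2 h).lt_of_ne hk)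
    exact ⟨b, EReal.coe_lt_coe_iff.1 hb2, (hle k b).1 hb1.le⟩
  have hsub : ∀ {b : ℝ}, (∃ x, sphereLift f x ≤ b) ↔
      ¬ OddNonvanishing {x | sphereLift f x ≤ b} 0 := by
    intro b
    refine ⟨fun ⟨x, hx⟩ ⟨h, _, h0⟩ => h0 x hx (Subsingleton.elim _ _), fun h => ?_⟩
    by_contra! hx
    exact h ⟨0, by simp, fun x hx' => absurd hx' (not_le.2 (hx x))⟩
  let K : Set (RP 2) := {x | f x ≤ a}
  have hK : IsClosed K := isClosed_le hf continuous_const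
  have hfact : Fact (Module.finrank ℝ (EuclideanSpace ℝ (Fin 3)) = 2 + 1) := ⟨by simp⟩
  have hrank : 1 < Module.rank ℝ (EuclideanSpace ℝ (Fin 3)) := by
    rw [← Module.finrank_eq_rank, hfact.out]
    norm_num
  have hpath : PathConnectedSpace (sphere (0 : EuclideanSpace ℝ (Fin 3)) 1) :=
    isPathConnected_iff_pathConnectedSpace.1 (isPathConnected_sphere hrank 0 zero_le_one)
  change ∃ H : C(K × I, RP 2), (∀ x, H (x, 0) = x) ∧ ∀ x, f (H (x, 1)) < a
  by_cases hKe : ∃ x, sphereLift f x ≤ a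
  swap
  · have : IsEmpty K := ⟨fun x => by
      obtain ⟨y, hy⟩ := antipodalMk_surjective (x : RP 2)
      exact hKe ⟨y, by
        change f (antipodalMk y) ≤ a
        rw [hy]
        exact x.2⟩⟩
    exact ⟨.const _ (antipodalMk (Classical.arbitrary _)), fun x => isEmptyElim x,
      fun x => isEmptyElim x⟩
  have hS0 := hsub.1 hKe
  obtain ⟨b₁, hb₁, hb₁'⟩ := hlt 1 h1 fun m hm => by
    rwa [Nat.lt_one_iff.1 hm]
  obtain ⟨x₀, hx₀⟩ := hsub.2 (hb₁' 0 one_pos)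
  -- Genus one: contract `K` to a point and move that point to `[x₀]`, where `f < a`.
  by_cases hS1 : OddNonvanishing {x | sphereLift f x ≤ a} 1
  · obtain ⟨c, hc⟩ := contractibleIn_of_oddNonvanishing (C := K) hS1
    have hc' : ContinuousMap.Homotopic (.const K c) (.const K (antipodalMk x₀)) := by
      have hj : Joined c (antipodalMk x₀) := PathConnectedSpace.joined _ _
      obtain ⟨y, hy⟩ := hKe
      have : Nonempty K := ⟨antipodalMk y, hy⟩
      exact ContinuousMap.homotopic_const_iff.2 hj
    obtain ⟨H⟩ := hc.trans hc'
    refine ⟨H.toContinuousMap.comp ContinuousMap.prodSwap, fun x => H.apply_zero x, fun x => ?_⟩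
    have : H.toContinuousMap.comp ContinuousMap.prodSwap (x, 1) = antipodalMk x₀ := H.apply_one x
    rw [this]
    exact lt_of_le_of_lt hx₀ hb₁
  obtain ⟨b₂, hb₂, hb₂'⟩ := hlt 2 h2 fun m hm => by
    interval_cases m
    · exact hS0
    · exact hS1
  -- Genus at least two: unless `K` is everything, the loop coming from level `b₂` receives it.
  by_cases hKu : K = univ
  swap
  · exact exists_deformation_of_not_oddNonvanishing (by simp) (isOpen_lt hf continuous_const) hKu
      (isClosed_le hg continuous_const)
      (neg_mem_preimage_antipodalMk {x | f x ≤ b₂}) (fun x hx => lt_of_le_of_lt hx hb₂)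
      (hb₂' 1 (by norm_num))
  obtain ⟨b₃, hb₃, hb₃'⟩ := hlt 3 h3 fun m hm h => by
    refine not_oddNonvanishing_univ hm (h.mono fun x _ => ?_)
    have : antipodalMk x ∈ K := hKu ▸ mem_univ _
    exact this
  -- The constant homotopy works: a point with `f ≥ a` would be missed by `{f ≤ b₃}`, whose preimage
  -- would then have genus at most two.
  refine ⟨⟨fun z => z.1, by fun_prop⟩, fun x => rfl, fun x => ?_⟩
  by_contra hx
  refine hb₃' 2 (by norm_num) (oddNonvanishing_of_notMem (A := {x | f x ≤ b₃}) (q := x) ?_)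
  exact fun hx' => hx (lt_of_le_of_lt hx' hb₃)

/-- Below the minimum of `f` the sublevel set is empty, of genus 0; at an upper bound it is the
whole sphere, of genus at least 3. So the infimum in the extended reals is finite. -/
theorem exists_kr_eq_coe {f : RP 2 → ℝ} (hf : Continuous f) {k : ℕ} (hk : 0 < k) (hk3 : k ≤ 3) :
    ∃ a : ℝ, kr (sphereLift f) k = a := by
  have hg := continuous_sphereLift hf
  have hle := kr_le_iff hg (sphereLift_neg f) k
  obtain ⟨M, hM⟩ := (isCompact_range hg).bddAbove
  obtain ⟨L, hL⟩ := (isCompact_range hg).bddBelow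
  have h1 : kr (sphereLift f) k ≤ M := (hle M).2 fun m hm h =>
    not_oddNonvanishing_univ (hm.trans_le hk3) (h.mono fun x _ => hM (mem_range_self x))
  have h2 : ¬ kr (sphereLift f) k ≤ ((L - 1 : ℝ) : EReal) := fun h => by
    refine (hle (L - 1)).1 h 0 hk ⟨0, by simp, fun x hx => ?_⟩
    have h3 : L ≤ sphereLift f x := hL (mem_range_self x)
    have h4 : sphereLift f x ≤ L - 1 := hx
    linarith
  refine ⟨(kr (sphereLift f) k).toReal, (EReal.coe_toReal ?_ ?_).symm⟩
  · exact (h1.trans_lt (EReal.coe_lt_top M)).ne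
  · intro h
    exact h2 (h ▸ bot_le)

end Spectrum

theorem mainTheorem8 (f : RP 2 → ℝ) (hf : Continuous f) :
    (fun a : ℝ => (a : EReal)) '' homotopySignificantSpectrum f = {hs f 1, hs f 2, hs f 3} ∧
    (fun a : ℝ => (a : EReal)) '' homotopySignificantSpectrum f =
      {kr (sphereLift f) 1, kr (sphereLift f) 2, kr (sphereLift f) 3} := by
  have hne : Nonempty (sphere (0 : EuclideanSpace ℝ (Fin 3)) 1) :=
    (NormedSpace.sphere_nonempty.2 zero_le_one).to_subtype
  rw [hs_eq_kr, hs_eq_kr, hs_eq_kr, and_self]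
  refine Subset.antisymm ?_ ?_
  · rintro _ ⟨a, ha, rfl⟩
    rcases exists_kr_eq_of_mem_homotopySignificantSpectrum hf ha with h | h | h <;> simp [← h]
  · have key : ∀ k : ℕ, 0 < k → k ≤ 3 → kr (sphereLift f) k ∈
        (fun a : ℝ => (a : EReal)) '' homotopySignificantSpectrum f := by
      intro k hk hk3
      obtain ⟨a, ha⟩ := exists_kr_eq_coe hf hk hk3
      exact ⟨a, mem_homotopySignificantSpectrum_of_kr_eq hf ha, ha.symm⟩
    rintro _ (rfl | rfl | rfl)
    · exact key 1 (by norm_num) (by norm_num)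
    · exact key 2 (by norm_num) (by norm_num)
    · exact key 3 (by norm_num) (by norm_num)
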